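/- Let $E$ be a finite set, let $P,Q$ be irreducible and aperiodic stochastic $E\times E$ matrices with left invariant probability vectors $\pi_P,\pi_Q$, and let $f:E\times E\to\mathbb Z$. For a vector $\nu$ on $E\times E$ write $\nu(f)=\sum_{x,y}f(x,y)\nu(x,y)$. A cycle with respect to $P$ is a finite sequence $x_1,\dots,x_n$ in $E$ ($n\ge 1$) such that $P_{x_i,x_{i+1}}>0$ for $i=1,\dots,n$, indices being taken modulo $n$; cycles with respect to $Q$ are defined likewise. Assume the following. (a) $\mu=\pi_P\otimes\pi_Q(f)<0$. (b) For some $n\ge1$ there are cycles $x_1,\dots,x_n$ (with respect to $P$) and $y_1,\dots,y_n$ (with respect to $Q$) with $\sum_{k=1}^n f(x_k,y_k)>0$. (c) For every $T\ge 1$ there are an $n\ge1$ and cycles $x_1,\dots,x_n$ (with respect to $P$) and $y_1,\dots,y_n$ (with respect to $Q$) with $\sum_{k=1}^n f(x_k,y_k)\neq\sum_{k=1}^n f(x_k,y_{k+T \,(\mathrm{mod}\ n)})$. For $\theta\in\mathbb R$ let $\Phi(\theta)_{(x,y),(x',y')}=\exp(\theta f(x',y'))P_{x,x'}Q_{y,y'}$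 and let $\varphi(\theta)$ be the spectral radius of $\Phi(\theta)$. Let $\theta^*>0$ be a solution of $\varphi(\theta^*)=1$, let $r^*\neq0$ be a real right eigenvector of $\Phi(\theta^*)$ for the eigenvalue $1$, put $R^*_{(x,y),(x',y')}=\frac{r^*(x',y')}{r^*(x,y)}\Phi(\theta^*)_{(x,y),(x',y')}$, and let $\pi^*$ be a left invariant probability vector of $R^*$, with marginals $\pi_1^*,\pi_2^*$ on $E$. Put $\mu^*=\pi^*(f)$, and let $\mu_T^*=\mathbb E(f(X_1,Y_{1+T}))$, where $(X_n,Y_n)_{n\ge1}$ is the stationary Markov chain on $E\times E$ with transition matrix $R^*$ and initial distribution $\pi^*$. Then such $\theta^*,r^*,\pi^*$ exist, and for any such choice $$\pi_1^*\otimes\pi_Q(f)<\mu^*,\qquad \pi_P\otimes\pi_2^*(f)<\mu^*,$$ and the sequence $(\mu_T^*)_{T\ge1}$ converges, with $$\mu_\infty^*:=\lim_{T\to\infty}\mu_T^*=\pi_1^*\otimes\pi_2^*(f)<\mu^*.$$ -/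

import Mathlib

open Filter Topology Matrix

noncomputable section

namespace LocalAlignment

/-- Aperiodicity of a transition matrix: for every state `x`, the greatest common divisor of the
set `{n ≥ 1 | (Pⁿ)(x, x) > 0}` of possible return times is `1`. -/
def IsAperiodic {E : Type*} [Fintype E] [DecidableEq E] (P : Matrix E E ℝ) : Prop :=
  ∀ x : E, ∀ d : ℕ, (∀ n : ℕ, 1 ≤ n → 0 < (P ^ n) x x → d ∣ n) → d = 1

/-- `p` is a probability vector that is left invariant for the matrix `P`, i.e. `p P = p`. -/
def IsInvariantProb {S : Type*} [Fintype S] (P : Matrix S S ℝ) (p : S → ℝ) : Prop :=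
  p ∈ stdSimplex ℝ S ∧ p ᵥ* P = p

/-- A cycle of length `n` with respect to `P`, written as an `n`-periodic sequence all of whose
successive transitions have positive probability; indices modulo `n` are thereby automatic. -/
def IsCycle {E : Type*} (P : Matrix E E ℝ) (n : ℕ) (x : ℕ → E) : Prop :=
  Function.Periodic x n ∧ ∀ k : ℕ, 0 < P (x k) (x (k + 1))

/-- The product `p ⊗ q` of two vectors, as a vector on `E × E`. -/
def prodVec {E : Type*} (p q : E → ℝ) : E × E → ℝ := fun z => p z.1 * q z.2

/-- `ν(f) = ∑_{x,y} f(x,y) ν(x,y)`. -/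
def mean {E : Type*} [Fintype E] (ν : E × E → ℝ) (f : E → E → ℤ) : ℝ :=
  ∑ z : E × E, (f z.1 z.2 : ℝ) * ν z

/-- First marginal of a vector on `E × E`. -/
def marg₁ {E : Type*} [Fintype E] (ν : E × E → ℝ) : E → ℝ := fun x => ∑ y, ν (x, y)

/-- Second marginal of a vector on `E × E`. -/
def marg₂ {E : Type*} [Fintype E] (ν : E × E → ℝ) : E → ℝ := fun y => ∑ x, ν (x, y)

/-- There are `n ≥ 1` and cycles `x`, `y` of length `n` with `∑ f(x_k, y_k) > 0`. -/
def HasPositiveCycle {E : Type*} (P Q : Matrix E E ℝ) (f : E → E → ℤ) : Prop :=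
  ∃ n : ℕ, 1 ≤ n ∧ ∃ x y : ℕ → E, IsCycle P n x ∧ IsCycle Q n y ∧
    0 < ∑ k ∈ Finset.range n, f (x k) (y k)

/-- For every shift `T ≥ 1` there are `n ≥ 1` and cycles `x`, `y` of length `n` with
`∑ f(x_k, y_k) ≠ ∑ f(x_k, y_{k+T})`, where the sums run over one period and the index `k + T` is
taken modulo `n`. -/
def HasShiftSensitiveCycles {E : Type*} (P Q : Matrix E E ℝ) (f : E → E → ℤ) : Prop :=
  ∀ T : ℕ, 1 ≤ T → ∃ n : ℕ, 1 ≤ n ∧ ∃ x y : ℕ → E, IsCycle P n x ∧ IsCycle Q n y ∧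
    ∑ k ∈ Finset.range n, f (x k) (y k) ≠ ∑ k ∈ Finset.range n, f (x k) (y (k + T))

/-- `Φ(θ)_{(x,y),(x',y')} = exp(θ f(x',y')) P_{x,x'} Q_{y,y'}`. -/
def Phi {E : Type*} (P Q : Matrix E E ℝ) (f : E → E → ℤ) (θ : ℝ) :
    Matrix (E × E) (E × E) ℝ :=
  Matrix.of fun z z' => Real.exp (θ * (f z'.1 z'.2 : ℝ)) * P z.1 z'.1 * Q z.2 z'.2

/-- `φ(θ)`, the spectral radius of `Φ(θ)` (over the complex numbers, with values in `[0, ∞]`). -/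
def phi {E : Type*} [Fintype E] [DecidableEq E] (P Q : Matrix E E ℝ) (f : E → E → ℤ) (θ : ℝ) :
    ENNReal :=
  spectralRadius ℂ ((Phi P Q f θ).map Complex.ofReal)

/-- The tilted matrix `R_{z,z'} = (r(z') / r(z)) Φ(θ)_{z,z'}`. -/
def tiltedMatrix {E : Type*} (P Q : Matrix E E ℝ) (f : E → E → ℤ) (θ : ℝ) (r : E × E → ℝ) :
    Matrix (E × E) (E × E) ℝ :=
  Matrix.of fun z z' => r z' / r z * Phi P Q f θ z z'

/-- `θ`, `r`, `ν` are the tilting data `θ*`, `r*`, `π*`: `θ > 0` solves `φ(θ) = 1`, `r` is a right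
eigenvector of `Φ(θ)` for the eigenvalue `1`, and `ν` is a left invariant probability vector of the
tilted matrix `R*` built from `θ` and `r`. -/
structure IsTilting {E : Type*} [Fintype E] [DecidableEq E] (P Q : Matrix E E ℝ)
    (f : E → E → ℤ) (θ : ℝ) (r ν : E × E → ℝ) : Prop where
  pos : 0 < θ
  phi_eq_one : phi P Q f θ = 1
  ne_zero : r ≠ 0
  eigen : Phi P Q f θ *ᵥ r = r
  invariant : IsInvariantProb (tiltedMatrix P Q f θ r) ν

/-- Probability of the path `z₀, …, z_T` for the Markov chain with initial distribution `ν` and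
transition matrix `R`. -/
def pathProb {S : Type*} (ν : S → ℝ) (R : Matrix S S ℝ) (T : ℕ) (z : Fin (T + 1) → S) : ℝ :=
  ν (z 0) * ∏ i : Fin T, R (z i.castSucc) (z i.succ)

/-- `E[f(X₁, Y_{1+T})]` for the Markov chain `(Xₙ, Yₙ)_{n ≥ 1}` on `E × E` with initial
distribution `ν` and transition matrix `R`; the path `z` stands for
`(X₁, Y₁), …, (X_{1+T}, Y_{1+T})`. -/
def shiftedMean {E : Type*} [Fintype E] (ν : E × E → ℝ) (R : Matrix (E × E) (E × E) ℝ)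
    (f : E → E → ℤ) (T : ℕ) : ℝ :=
  ∑ z : Fin (T + 1) → E × E, (f (z 0).1 (z (Fin.last T)).2 : ℝ) * pathProb ν R T z

end LocalAlignment

end

/-!
Write `R` for the tilted matrix and `ν` for its invariant probability vector.

*Existence of the tilting data.* The matrices `Φ(θ)` are primitive. Since `φ(θ) < 1` holds exactly
if some power of `Φ(θ)` has row sums below `1`, and `φ(θ) > 1` exactly if some power has a diagonal
entry above `1`, both conditions are open in `θ`. The first holds for small `θ > 0`: the row sums of
`Φ(θ)ⁿ` are `1` at `θ = 0`, and by the convergence theorem for Markov chains their derivatives there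
are asymptotic to `n μ`, hence negative for large `n`. The second holds for large `θ`, by following
a cycle of positive weight. So `φ = 1` somewhere in between (`exists_phi_eq_one`), and
Perron–Frobenius (`exists_pos_eigenvector`) provides the positive eigenvector. Any other real
eigenvector for the eigenvalue `1` is a multiple of it, so `R` does not depend on the choice.

*The limit of the shifted means.* `E[f(X₁, Y_{1+T})]` is a linear function of the entries of
`R ^ T`, and the rows of `R ^ T` converge to `ν` (`tendsto_pow_apply`).

*The inequalities.* All three are instances of `mean_prodVec_lt`. Let `A` be either `P` or the
transition matrix of the first coordinate of the stationary tilted chain, let `B` be `Q`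
or the corresponding matrix for the second coordinate, with invariant vectors `a`, `b`, and let
`G = A ⊗ B`. As `log R` equals `θ f + log (P ⊗ Q)` up to a coboundary, nonnegativity of the
conditional relative entropy of `R` with respect to `G` reads `H(A | P) + H(B | Q) ≤ θ ν(f)`, and
that of `G` with respect to `R` reads `θ (a ⊗ b)(f) ≤ H(A | P) + H(B | Q)`. Working with transition matrices in place
of the (non-Markov) coordinate processes suffices. If equality held, then `R = A ⊗ B`, so `θ f`
would be, up to a coboundary, a sum of a function of `(x, x')` and a function of `(y, y')`, and its
sums over pairs of cycles could not detect a shift.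
-/

namespace LocalAlignment

/-! ### Powers of nonnegative matrices and convergence of finite Markov chains -/

section

variable {S : Type*} [Fintype S] [DecidableEq S]

lemma mul_le_pow_add {A : Matrix S S ℝ} (hA : ∀ i j, 0 ≤ A i j) (m n : ℕ) (i j k : S) :
    (A ^ m) i j * (A ^ n) j k ≤ (A ^ (m + n)) i k := by
  rw [pow_add, Matrix.mul_apply]
  exact Finset.single_le_sum (f := fun j => (A ^ m) i j * (A ^ n) j k)
    (fun j _ => mul_nonneg (pow_apply_nonneg hA m i j) (pow_apply_nonneg hA n j k))
    (Finset.mem_univ j)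

/-- An irreducible aperiodic matrix has all its large powers entrywise positive: the return times
of a state form an additive monoid with greatest common divisor `1`, so they contain all large
integers. -/
theorem exists_forall_pow_pos {P : Matrix S S ℝ} (hirr : P.IsIrreducible) (hap : IsAperiodic P) :
    ∃ N : ℕ, ∀ n, N ≤ n → ∀ i j, 0 < (P ^ n) i j := by
  have hnn := hirr.nonneg
  have hret : ∀ x, ∃ N : ℕ, ∀ n, N ≤ n → 0 < (P ^ n) x x := by
    intro x
    let s : AddSubmonoid ℕ :=
      { carrier := {n | 0 < (P ^ n) x x}
        zero_mem' := by simp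
        add_mem' := fun {a b} ha hb => (mul_pos ha hb).trans_le (mul_le_pow_add hnn a b x x x) }
    have hg : Nat.setGcd (s : Set ℕ) = 1 :=
      hap x _ fun n _ hn => Nat.setGcd_dvd_of_mem (s := (s : Set ℕ)) hn
    obtain ⟨N, hN⟩ := Nat.exists_mem_closure_of_ge (s := (s : Set ℕ))
    refine ⟨N, fun n hn => ?_⟩
    have := hN n hn (by simp [hg])
    rw [AddSubmonoid.closure_eq] at this
    exact this
  choose N hN using hret
  choose k hk0 hk using (isIrreducible_iff_exists_pow_pos hnn).1 hirr
  refine ⟨Finset.univ.sup fun p : S × S => N p.1 + k p.1 p.2, fun n hn i j => ?_⟩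
  have h1 : N i + k i j ≤ n :=
    (Finset.le_sup (f := fun p : S × S => N p.1 + k p.1 p.2) (Finset.mem_univ (i, j))).trans hn
  have h2 := mul_le_pow_add hnn (n - k i j) (k i j) i i j
  rw [Nat.sub_add_cancel (by omega)] at h2
  exact (mul_pos (hN i _ (by omega)) (hk i j)).trans_le h2

lemma vecMul_pow_eq {R : Matrix S S ℝ} {p : S → ℝ} (h : p ᵥ* R = p) (n : ℕ) :
    p ᵥ* R ^ n = p := by
  induction n with
  | zero => simp
  | succ n ih => rw [pow_succ, ← Matrix.vecMul_vecMul, ih, h]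

lemma pow_mulVec_eq {R : Matrix S S ℝ} {g : S → ℝ} (h : R *ᵥ g = g) (n : ℕ) :
    R ^ n *ᵥ g = g := by
  induction n with
  | zero => simp
  | succ n ih => rw [pow_succ, ← Matrix.mulVec_mulVec, h, ih]

/-- A row stochastic matrix with a positive power has a positive invariant probability vector:
a real left eigenvector for the eigenvalue `1` exists because `1` is a right eigenvalue, and its
absolute value is again a left eigenvector since stochastic matrices preserve the total mass. -/
theorem exists_invariantProb [Nonempty S] {R : Matrix S S ℝ} (hR : R ∈ rowStochastic ℝ S)
    (hprim : R.IsPrimitive) :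
    ∃ p, IsInvariantProb R p ∧ ∀ i, 0 < p i := by
  have hnn := hprim.nonneg
  have hdet : (R - 1).det = 0 := by
    rw [← Matrix.exists_mulVec_eq_zero_iff]
    exact ⟨1, one_ne_zero, by rw [Matrix.sub_mulVec, hR.2, Matrix.one_mulVec, sub_self]⟩
  obtain ⟨v, hv0, hv⟩ := Matrix.exists_vecMul_eq_zero_iff.2 hdet
  rw [Matrix.vecMul_sub, Matrix.vecMul_one, sub_eq_zero] at hv
  have hle : ∀ j, |v j| ≤ ((fun i => |v i|) ᵥ* R) j := by
    intro j
    calc |v j| = |∑ i, v i * R i j| := by rw [← congrFun hv j]; rfl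
      _ ≤ ∑ i, |v i * R i j| := Finset.abs_sum_le_sum_abs _ _
      _ = ((fun i => |v i|) ᵥ* R) j := by
        simp [Matrix.vecMul, dotProduct, abs_mul, abs_of_nonneg (hnn _ _)]
  have hsum : ∑ j, |v j| = ∑ j, ((fun i => |v i|) ᵥ* R) j := by
    simp only [Matrix.vecMul, dotProduct]
    rw [Finset.sum_comm]
    simp [← Finset.mul_sum, sum_row_of_mem_rowStochastic hR]
  have heq : (fun i => |v i|) ᵥ* R = fun i => |v i| := by
    funext j
    exact (((Finset.sum_eq_sum_iff_of_le fun j _ => hle j).1 hsum) j (Finset.mem_univ j)).symm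
  have hpos : 0 < ∑ j, |v j| := by
    obtain ⟨i, hi⟩ := Function.ne_iff.1 hv0
    exact Finset.sum_pos' (fun _ _ => abs_nonneg _) ⟨i, Finset.mem_univ i, abs_pos.2 hi⟩
  set c := ∑ j, |v j| with hc
  have hinv : (fun i => |v i| / c) ᵥ* R = fun i => |v i| / c := by
    have : (fun i => |v i| / c) = c⁻¹ • fun i => |v i| := by
      funext i; simp [div_eq_inv_mul]
    rw [this, Matrix.smul_vecMul, heq]
  refine ⟨fun i => |v i| / c, ⟨⟨fun i => by positivity, ?_⟩, hinv⟩, fun j => ?_⟩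
  · rw [← Finset.sum_div, ← hc, div_self hpos.ne']
  · obtain ⟨k, -, hk⟩ := hprim.exists_pos_pow
    refine lt_of_lt_of_eq ?_ (congrFun (vecMul_pow_eq hinv k) j)
    obtain ⟨i, hi⟩ := Function.ne_iff.1 hv0
    exact Finset.sum_pos' (fun i _ => mul_nonneg (by positivity) (hk i j).le)
      ⟨i, Finset.mem_univ i, mul_pos (div_pos (abs_pos.2 hi) hpos) (hk i j)⟩

/-- Convergence theorem for finite Markov chains. If `Rᵏ ≥ δ 1 p` entrywise, the defect
`max_i |(Rⁿ)_{i,j} - p_j|` shrinks by the factor `1 - δ` every `k` steps. -/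
theorem tendsto_pow_apply [Nonempty S] {R : Matrix S S ℝ} (hR : R ∈ rowStochastic ℝ S)
    (hprim : R.IsPrimitive) {p : S → ℝ} (hp : IsInvariantProb R p) (i j : S) :
    Tendsto (fun n : ℕ => (R ^ n) i j) atTop (𝓝 (p j)) := by
  obtain ⟨k, hk0, hk⟩ := hprim.exists_pos_pow
  have hst : ∀ n : ℕ, R ^ n ∈ rowStochastic ℝ S := fun n => pow_mem hR n
  obtain ⟨δ, hδ0, hδ1, hδ⟩ : ∃ δ : ℝ, 0 < δ ∧ δ < 1 ∧ ∀ i j, δ ≤ (R ^ k) i j := by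
    obtain ⟨m, hm⟩ := Finite.exists_min fun q : S × S => (R ^ k) q.1 q.2
    refine ⟨min ((R ^ k) m.1 m.2) (1 / 2), lt_min (hk _ _) (by norm_num),
      (min_le_right _ _).trans_lt (by norm_num), fun i j => (min_le_left _ _).trans (hm (i, j))⟩
  have hp1 : ∀ j, p j ≤ 1 := fun j => by
    rw [← hp.1.2]; exact Finset.single_le_sum (fun i _ => hp.1.1 i) (Finset.mem_univ j)
  have hminor : ∀ i j, δ * p j ≤ (R ^ k) i j := fun i j =>
    (mul_le_of_le_one_right hδ0.le (hp1 j)).trans (hδ i j)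
  have hdiff : ∀ n m i j, (R ^ (m + n)) i j - p j = ∑ l, (R ^ m) i l * ((R ^ n) l j - p j) := by
    intro n m i j
    rw [pow_add, Matrix.mul_apply]
    simp [mul_sub, Finset.sum_sub_distrib, ← Finset.sum_mul,
      sum_row_of_mem_rowStochastic (hst m)]
  -- Subtracting `δ 1 p` from `Rᵏ` changes nothing, as `p` annihilates the defect.
  have hdiff' : ∀ n i j, (R ^ (k + n)) i j - p j
      = ∑ l, ((R ^ k) i l - δ * p l) * ((R ^ n) l j - p j) := by
    intro n i j
    have h0 : ∑ l, p l * ((R ^ n) l j - p j) = 0 := by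
      have := congrFun (vecMul_pow_eq hp.2 n) j
      simp only [Matrix.vecMul, dotProduct] at this
      rw [Finset.sum_congr rfl fun l _ => mul_sub _ _ _, Finset.sum_sub_distrib, this,
        ← Finset.sum_mul, hp.1.2, one_mul, sub_self]
    rw [hdiff]
    simp only [sub_mul, Finset.sum_sub_distrib, mul_assoc, ← Finset.mul_sum, h0]
    simp
  have hmono : ∀ (n m : ℕ) (c : ℝ), (∀ i, |(R ^ n) i j - p j| ≤ c) →
      ∀ i, |(R ^ (m + n)) i j - p j| ≤ c := by
    intro n m c hc i
    rw [hdiff]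
    calc |∑ l, (R ^ m) i l * ((R ^ n) l j - p j)|
        ≤ ∑ l, |(R ^ m) i l * ((R ^ n) l j - p j)| := Finset.abs_sum_le_sum_abs _ _
      _ ≤ ∑ l, (R ^ m) i l * c := Finset.sum_le_sum fun l _ => by
          rw [abs_mul, abs_of_nonneg ((hst m).1 i l)]
          exact mul_le_mul_of_nonneg_left (hc l) ((hst m).1 i l)
      _ = c := by rw [← Finset.sum_mul, sum_row_of_mem_rowStochastic (hst m), one_mul]
  have hcontr : ∀ (n : ℕ) (c : ℝ), (∀ i, |(R ^ n) i j - p j| ≤ c) →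
      ∀ i, |(R ^ (k + n)) i j - p j| ≤ (1 - δ) * c := by
    intro n c hc i
    rw [hdiff']
    calc |∑ l, ((R ^ k) i l - δ * p l) * ((R ^ n) l j - p j)|
        ≤ ∑ l, |((R ^ k) i l - δ * p l) * ((R ^ n) l j - p j)| := Finset.abs_sum_le_sum_abs _ _
      _ ≤ ∑ l, ((R ^ k) i l - δ * p l) * c := Finset.sum_le_sum fun l _ => by
          have := sub_nonneg.2 (hminor i l)
          rw [abs_mul, abs_of_nonneg this]
          exact mul_le_mul_of_nonneg_left (hc l) this
      _ = (1 - δ) * c := by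
          rw [← Finset.sum_mul, Finset.sum_sub_distrib, sum_row_of_mem_rowStochastic (hst k),
            ← Finset.mul_sum, hp.1.2, mul_one]
  obtain ⟨c, hc⟩ : ∃ c, ∀ i, |(R ^ 0) i j - p j| ≤ c := by
    obtain ⟨m, hm⟩ := Finite.exists_max fun i => |(R ^ 0) i j - p j|
    exact ⟨_, hm⟩
  have hgeo : ∀ n : ℕ, ∀ i, |(R ^ (k * n)) i j - p j| ≤ (1 - δ) ^ n * c := by
    intro n
    induction n with
    | zero => simpa using hc
    | succ n ih =>
      intro i
      have := hcontr _ _ ih i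
      rw [← mul_assoc, ← pow_succ'] at this
      rwa [Nat.mul_succ, add_comm]
  rw [Metric.tendsto_atTop]
  intro ε hε
  have hlim : Tendsto (fun n : ℕ => (1 - δ) ^ n * c) atTop (𝓝 (0 * c)) :=
    (tendsto_pow_atTop_nhds_zero_of_lt_one (by linarith) (by linarith)).mul_const c
  rw [zero_mul] at hlim
  obtain ⟨n, hn⟩ := (hlim.eventually_lt_const hε).exists
  refine ⟨k * n, fun m hm => ?_⟩
  rw [Real.dist_eq]
  have := hmono _ (m - k * n) _ (hgeo n) i
  rw [Nat.sub_add_cancel hm] at this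
  exact this.trans_lt hn

/-- Invariant probability vectors of a primitive stochastic matrix are positive, since they all
agree with the limit of the rows of its powers. -/
lemma IsInvariantProb.pos [Nonempty S] {R : Matrix S S ℝ} (hR : R ∈ rowStochastic ℝ S)
    (hprim : R.IsPrimitive) {p : S → ℝ} (hp : IsInvariantProb R p) (i : S) : 0 < p i := by
  obtain ⟨q, hq, hqpos⟩ := exists_invariantProb hR hprim
  rw [tendsto_nhds_unique (tendsto_pow_apply hR hprim hp i i)
    (tendsto_pow_apply hR hprim hq i i)]
  exact hqpos i

/-- Harmonic functions of a primitive stochastic matrix are constant. -/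
lemma harmonic_eq [Nonempty S] {R : Matrix S S ℝ} (hR : R ∈ rowStochastic ℝ S)
    (hprim : R.IsPrimitive) {g : S → ℝ} (hg : R *ᵥ g = g) (i i' : S) : g i = g i' := by
  obtain ⟨p, hp, -⟩ := exists_invariantProb hR hprim
  have key : ∀ i, g i = ∑ j, p j * g j := fun i => by
    have h1 : Tendsto (fun n : ℕ => ∑ j, (R ^ n) i j * g j) atTop (𝓝 (∑ j, p j * g j)) :=
      tendsto_finsetSum _ fun j _ => (tendsto_pow_apply hR hprim hp i j).mul_const _
    refine tendsto_nhds_unique ?_ h1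
    refine tendsto_const_nhds.congr fun n => ?_
    exact (congrFun (pow_mulVec_eq hg n) i).symm
  rw [key i, key i']

end

/-! ### Spectral radius and Perron–Frobenius eigenvector of nonnegative matrices -/

section SpectralRadius

variable {S : Type*} [Fintype S] [DecidableEq S]

attribute [local instance] Matrix.linftyOpNormedRing Matrix.linftyOpNormedAlgebra

lemma map_ofReal_pow (A : Matrix S S ℝ) (n : ℕ) :
    A.map Complex.ofReal ^ n = (A ^ n).map Complex.ofReal :=
  (map_pow Complex.ofRealHom.mapMatrix A n).symm

lemma norm_map_ofReal_lt_iff {A : Matrix S S ℝ} (hA : ∀ i j, 0 ≤ A i j) {c : ℝ} (hc : 0 < c) :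
    ‖A.map Complex.ofReal‖ < c ↔ ∀ i, ∑ j, A i j < c := by
  lift c to NNReal using hc.le
  rw [Matrix.linfty_opNorm_def, NNReal.coe_lt_coe, Finset.sup_lt_iff (by exact_mod_cast hc)]
  refine ⟨fun h i => ?_, fun h i _ => ?_⟩
  · have := NNReal.coe_lt_coe.2 (h i (Finset.mem_univ i))
    simpa [abs_of_nonneg (hA _ _)] using this
  · rw [← NNReal.coe_lt_coe]
    simpa [abs_of_nonneg (hA _ _)] using h i

lemma apply_le_norm_map_ofReal {A : Matrix S S ℝ} (hA : ∀ i j, 0 ≤ A i j) (i j : S) :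
    A i j ≤ ‖A.map Complex.ofReal‖ := by
  refine le_of_forall_gt fun c hc => ?_
  have h := (norm_map_ofReal_lt_iff hA ((norm_nonneg _).trans_lt hc)).1 hc i
  exact (Finset.single_le_sum (fun j _ => hA i j) (Finset.mem_univ j)).trans_lt h

/-- A diagonal entry `c > 1` of `Aⁿ` would give `cᵏ ≤ ‖Aⁿᵏ‖` for all `k`, so a spectral radius of at
least `c ^ (1 / n) > 1` by Gelfand's formula. -/
lemma pow_apply_self_le_one {A : Matrix S S ℝ} (hA : ∀ i j, 0 ≤ A i j)
    (h : spectralRadius ℂ (A.map Complex.ofReal) ≤ 1) {n : ℕ} (hn : n ≠ 0) (i : S) :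
    (A ^ n) i i ≤ 1 := by
  by_contra! hcon
  set a := (A ^ n) i i with ha
  have hpow : ∀ k : ℕ, a ^ k ≤ (A ^ (n * k)) i i := by
    intro k
    induction k with
    | zero => simp
    | succ k ih =>
      rw [pow_succ, Nat.mul_succ]
      exact (mul_le_mul_of_nonneg_right ih (by linarith)).trans
        (mul_le_pow_add hA (n * k) n i i i)
  have hlim := (spectrum.pow_norm_pow_one_div_tendsto_nhds_spectralRadius
      (A.map Complex.ofReal)).comp
        (tendsto_id.const_mul_atTop' (Nat.pos_of_ne_zero hn))
  have hge : ENNReal.ofReal (a ^ (1 / n : ℝ)) ≤ spectralRadius ℂ (A.map Complex.ofReal) := by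
    refine ge_of_tendsto hlim ?_
    filter_upwards [eventually_ne_atTop 0] with k hk
    simp only [Function.comp_apply, id]
    refine ENNReal.ofReal_le_ofReal ?_
    have h1 : a ^ k ≤ ‖A.map Complex.ofReal ^ (n * k)‖ := by
      rw [map_ofReal_pow]
      exact (hpow k).trans (apply_le_norm_map_ofReal (pow_apply_nonneg hA _) i i)
    have h2 : a ^ (1 / n : ℝ) = (a ^ k) ^ (1 / ((n * k : ℕ) : ℝ)) := by
      rw [← Real.rpow_natCast, ← Real.rpow_mul (by linarith)]
      congr 1
      push_cast
      field_simp
    rw [h2]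
    exact Real.rpow_le_rpow (by positivity) h1 (by positivity)
  have h3 : 1 < a ^ (1 / n : ℝ) :=
    Real.one_lt_rpow hcon (by have := Nat.pos_of_ne_zero hn; positivity)
  exact (ENNReal.one_lt_ofReal.2 h3).not_ge (hge.trans h)

variable [Nonempty S]

/-- The spectral radius of a nonnegative matrix is less than `1` exactly if some power has all row
sums less than `1`. -/
theorem spectralRadius_lt_one_iff {A : Matrix S S ℝ} (hA : ∀ i j, 0 ≤ A i j) :
    spectralRadius ℂ (A.map Complex.ofReal) < 1 ↔ ∃ n : ℕ, n ≠ 0 ∧ ∀ i, ∑ j, (A ^ n) i j < 1 := by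
  constructor
  · intro h
    have hev := (spectrum.pow_norm_pow_one_div_tendsto_nhds_spectralRadius
      (A.map Complex.ofReal)).eventually_lt_const h
    obtain ⟨n, hn, hn0⟩ := (hev.and (eventually_ne_atTop 0)).exists
    refine ⟨n, hn0, ?_⟩
    rw [ENNReal.ofReal_lt_one] at hn
    rw [← norm_map_ofReal_lt_iff (pow_apply_nonneg hA n) one_pos, ← map_ofReal_pow]
    by_contra! hcon
    exact hn.not_ge (Real.one_le_rpow hcon (by positivity))
  · rintro ⟨n, hn0, hn⟩
    rw [← norm_map_ofReal_lt_iff (pow_apply_nonneg hA n) one_pos, ← map_ofReal_pow] at hn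
    have h1 := (spectrum.spectralRadius_pow_le (𝕜 := ℂ) (A.map Complex.ofReal) n hn0).trans
      (spectrum.spectralRadius_le_nnnorm _)
    have h2 : ((‖A.map Complex.ofReal ^ n‖₊ : NNReal) : ENNReal) < 1 := by
      exact_mod_cast hn
    by_contra! hcon
    exact (h1.trans_lt h2).not_ge (one_le_pow_of_one_le' hcon n)

/-- By irreducibility every entry of `Aⁿ` is, up to a positive factor not depending on `n`, at most
a diagonal entry of a higher power. -/
lemma pow_apply_bounded {A : Matrix S S ℝ} (hA : A.IsIrreducible)
    (h : ∀ n : ℕ, n ≠ 0 → ∀ i, (A ^ n) i i ≤ 1) :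
    ∃ K : ℝ, 0 < K ∧ ∀ n i j, (A ^ n) i j ≤ K := by
  choose k hk0 hk using (isIrreducible_iff_exists_pow_pos hA.nonneg).1 hA
  obtain ⟨m, hm⟩ := Finite.exists_max fun q : S × S => ((A ^ k q.2 q.1) q.2 q.1)⁻¹
  refine ⟨_, inv_pos.2 (hk m.2 m.1), fun n i j => ?_⟩
  refine le_trans ?_ (hm (i, j))
  rw [← one_div, le_div_iff₀ (hk j i)]
  exact (mul_le_pow_add hA.nonneg n (k j i) i j i).trans
    (h _ (by have := hk0 j i; omega) i)

lemma spectralRadius_le_one {A : Matrix S S ℝ} (hA : ∀ i j, 0 ≤ A i j) {K : ℝ}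
    (h : ∀ n i j, (A ^ n) i j ≤ K) : spectralRadius ℂ (A.map Complex.ofReal) ≤ 1 := by
  obtain ⟨z, hz, hzr⟩ := spectrum.exists_nnnorm_eq_spectralRadius (A.map Complex.ofReal)
  rw [← hzr]
  by_contra! hcon
  have hz1 : 1 < ‖z‖ := by exact_mod_cast hcon
  obtain ⟨n, hn⟩ := pow_unbounded_of_one_lt (Fintype.card S * K + 1) hz1
  have h1 : ‖z ^ n‖ ≤ ‖A.map Complex.ofReal ^ n‖ :=
    spectrum.norm_le_norm_of_mem (spectrum.pow_mem_pow _ n hz)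
  have hK : 0 ≤ K := by
    obtain ⟨i⟩ := ‹Nonempty S›
    exact (hA i i).trans (by simpa using h 1 i i)
  have h2 : ‖A.map Complex.ofReal ^ n‖ < Fintype.card S * K + 1 := by
    rw [map_ofReal_pow, norm_map_ofReal_lt_iff (pow_apply_nonneg hA n) (by positivity)]
    intro i
    have : ∑ j, (A ^ n) i j ≤ ∑ _j : S, K := Finset.sum_le_sum fun j _ => h n i j
    simp only [Finset.sum_const, Finset.card_univ, nsmul_eq_mul] at this
    linarith
  rw [norm_pow] at h1
  linarith

/-- For an irreducible nonnegative matrix, spectral radius greater than `1` is witnessed by a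
diagonal entry of a power. -/
theorem one_lt_spectralRadius_iff {A : Matrix S S ℝ} (hA : A.IsIrreducible) :
    1 < spectralRadius ℂ (A.map Complex.ofReal) ↔ ∃ n : ℕ, n ≠ 0 ∧ ∃ i, 1 < (A ^ n) i i := by
  constructor
  · intro h
    by_contra! hcon
    obtain ⟨K, -, hK⟩ := pow_apply_bounded hA hcon
    exact h.not_ge (spectralRadius_le_one hA.nonneg hK)
  · rintro ⟨n, hn, i, hi⟩
    by_contra! hcon
    exact hi.not_ge (pow_apply_self_le_one hA.nonneg hcon hn i)

/-- Perron–Frobenius: a primitive matrix of spectral radius `1` has a positive eigenvector for the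
eigenvalue `1`. The absolute value `u` of an eigenvector for an eigenvalue of modulus `1` satisfies
`u ≤ A u`; if this were not an equality, then `w = Aᵏ u` would satisfy `c w ≤ A w` with `c > 1`,
and the powers of `A` would be unbounded. -/
theorem exists_pos_eigenvector {A : Matrix S S ℝ} (hA : A.IsPrimitive)
    (h : spectralRadius ℂ (A.map Complex.ofReal) = 1) :
    ∃ u : S → ℝ, (∀ i, 0 < u i) ∧ A *ᵥ u = u := by
  have hnn := hA.nonneg
  obtain ⟨z, hz, hzr⟩ := spectrum.exists_nnnorm_eq_spectralRadius (A.map Complex.ofReal)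
  have hz1 : ‖z‖ = 1 := by
    rw [h] at hzr
    have : ‖z‖₊ = 1 := by exact_mod_cast hzr
    simpa using congrArg NNReal.toReal this
  rw [← Matrix.spectrum_toLin', ← Module.End.hasEigenvalue_iff_mem_spectrum] at hz
  obtain ⟨v, hv⟩ := hz.exists_hasEigenvector
  have hv0 := hv.2
  have hvA : A.map Complex.ofReal *ᵥ v = z • v := by
    simpa using hv.apply_eq_smul
  set u : S → ℝ := fun i => ‖v i‖ with hu
  have hle : ∀ i, u i ≤ (A *ᵥ u) i := by
    intro i
    calc u i = ‖(z • v) i‖ := by simp [hu, hz1]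
      _ = ‖∑ j, (A i j : ℂ) * v j‖ := by rw [← hvA]; rfl
      _ ≤ ∑ j, ‖(A i j : ℂ) * v j‖ := norm_sum_le _ _
      _ = (A *ᵥ u) i := by
        simp [Matrix.mulVec, dotProduct, hu, abs_of_nonneg (hnn _ _)]
  obtain ⟨k, -, hk⟩ := hA.exists_pos_pow
  have hposk : ∀ g : S → ℝ, (∀ i, 0 ≤ g i) → g ≠ 0 → ∀ i, 0 < (A ^ k *ᵥ g) i := by
    intro g hg hg0 i
    obtain ⟨j, hj⟩ := Function.ne_iff.1 hg0
    exact Finset.sum_pos' (fun j _ => mul_nonneg (hk i j).le (hg j))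
      ⟨j, Finset.mem_univ j, mul_pos (hk i j) ((hg j).lt_of_ne' hj)⟩
  have hu0 : u ≠ 0 := by
    obtain ⟨j, hj⟩ := Function.ne_iff.1 hv0
    exact Function.ne_iff.2 ⟨j, by simpa [hu] using hj⟩
  have heq : A *ᵥ u = u := by
    by_contra hne
    have hgap := hposk (A *ᵥ u - u) (fun i => sub_nonneg.2 (hle i)) (sub_ne_zero.2 hne)
    have hw := hposk u (fun i => norm_nonneg _) hu0
    set w := A ^ k *ᵥ u with hwdef
    have hAw : ∀ i, w i < (A *ᵥ w) i := by
      intro i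
      have h1 := hgap i
      rw [Matrix.mulVec_sub, Matrix.mulVec_mulVec, ← pow_succ, pow_succ', ← Matrix.mulVec_mulVec,
        ← hwdef] at h1
      simpa using h1
    obtain ⟨m, hm⟩ := Finite.exists_min fun i => (A *ᵥ w) i / w i
    set c := (A *ᵥ w) m / w m with hc
    have hc1 : 1 < c := (one_lt_div (hw m)).2 (hAw m)
    have hcw : ∀ i, c * w i ≤ (A *ᵥ w) i := fun i => (le_div_iff₀ (hw i)).1 (hm i)
    have hpow : ∀ n i, c ^ n * w i ≤ (A ^ n *ᵥ w) i := by
      intro n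
      induction n with
      | zero => simp
      | succ n ih =>
        intro i
        rw [pow_succ' A, ← Matrix.mulVec_mulVec]
        calc c ^ (n + 1) * w i = c ^ n * (c * w i) := by ring
          _ ≤ c ^ n * (A *ᵥ w) i := by gcongr; exact hcw i
          _ = (A *ᵥ (fun j => c ^ n * w j)) i := by
            simp [Matrix.mulVec, dotProduct, Finset.mul_sum, mul_left_comm]
          _ ≤ (A *ᵥ (A ^ n *ᵥ w)) i := Finset.sum_le_sum fun j _ =>
            mul_le_mul_of_nonneg_left (ih j) (hnn i j)
    obtain ⟨K, hK0, hK⟩ := pow_apply_bounded hA.isIrreducible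
      fun n hn i => pow_apply_self_le_one hnn h.le hn i
    obtain ⟨n, hn⟩ := pow_unbounded_of_one_lt ((∑ j, K * w j) / w m) hc1
    rw [div_lt_iff₀ (hw m)] at hn
    have h2 : (A ^ n *ᵥ w) m ≤ ∑ j, K * w j := Finset.sum_le_sum fun j _ =>
      mul_le_mul_of_nonneg_right (hK n m j) (hw j).le
    linarith [hpow n m]
  exact ⟨u, fun i => by
    rw [← congrFun (pow_mulVec_eq heq k) i]; exact hposk u (fun i => norm_nonneg _) hu0 i, heq⟩

end SpectralRadius

/-! ### The matrices `Φ(θ)` and the solution of `φ(θ) = 1` -/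

section

variable {E : Type*} {P Q : Matrix E E ℝ}

/-- The product of the transition matrices `A` and `B`, for a pair of coordinates that
move independently. -/
def prodMatrix (A B : Matrix E E ℝ) : Matrix (E × E) (E × E) ℝ :=
  Matrix.of fun z z' => A z.1 z'.1 * B z.2 z'.2

lemma Phi_nonneg (hP : ∀ i j, 0 ≤ P i j) (hQ : ∀ i j, 0 ≤ Q i j) (f : E → E → ℤ) (θ : ℝ)
    (z z' : E × E) : 0 ≤ Phi P Q f θ z z' :=
  mul_nonneg (mul_nonneg (Real.exp_pos _).le (hP _ _)) (hQ _ _)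

lemma Phi_pos_iff (hP : ∀ i j, 0 ≤ P i j) (hQ : ∀ i j, 0 ≤ Q i j) (f : E → E → ℤ) (θ : ℝ)
    (z z' : E × E) : 0 < Phi P Q f θ z z' ↔ 0 < P z.1 z'.1 ∧ 0 < Q z.2 z'.2 := by
  constructor
  · intro h
    refine ⟨(hP _ _).lt_of_ne' fun h0 => ?_, (hQ _ _).lt_of_ne' fun h0 => ?_⟩ <;>
      simp [Phi, h0] at h
  · rintro ⟨h1, h2⟩
    exact mul_pos (mul_pos (Real.exp_pos _) h1) h2

lemma exists_pos_of_mem_rowStochastic [Fintype E] [DecidableEq E]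
    (hP : P ∈ rowStochastic ℝ E) (x : E) : ∃ x', 0 < P x x' := by
  by_contra! h
  have h1 := sum_row_of_mem_rowStochastic hP x
  have h2 := Finset.sum_nonpos fun j (_ : j ∈ Finset.univ) => h j
  linarith

lemma Phi_zero_eq (P Q : Matrix E E ℝ) (f : E → E → ℤ) :
    Phi P Q f 0 = prodMatrix P Q := by
  ext z z'; simp [Phi, prodMatrix]

/-- Products of invariant probability vectors are invariant for the product chain. -/
lemma isInvariantProb_prodVec [Fintype E] {A B : Matrix E E ℝ} {a b : E → ℝ}
    (ha : IsInvariantProb A a) (hb : IsInvariantProb B b) :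
    IsInvariantProb (prodMatrix A B) (prodVec a b) := by
  refine ⟨⟨fun z => mul_nonneg (ha.1.1 _) (hb.1.1 _), ?_⟩, ?_⟩
  · simp [prodVec, Fintype.sum_prod_type, ← Finset.mul_sum, ha.1.2, hb.1.2]
  · funext z
    have h1 := congrFun ha.2 z.1
    have h2 := congrFun hb.2 z.2
    simp only [Matrix.vecMul, dotProduct] at h1 h2
    simp only [prodVec, prodMatrix, Matrix.vecMul, dotProduct, Matrix.of_apply,
      Fintype.sum_prod_type]
    rw [← h1, ← h2, Finset.sum_mul_sum]
    exact Finset.sum_congr rfl fun x _ => Finset.sum_congr rfl fun y _ => by ring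

variable [Fintype E] [DecidableEq E]

lemma Phi_pow_pos (hP : ∀ i j, 0 ≤ P i j) (hQ : ∀ i j, 0 ≤ Q i j) (f : E → E → ℤ) (θ : ℝ)
    (n : ℕ) (z z' : E × E) (h1 : 0 < (P ^ n) z.1 z'.1) (h2 : 0 < (Q ^ n) z.2 z'.2) :
    0 < (Phi P Q f θ ^ n) z z' := by
  induction n generalizing z with
  | zero =>
    simp only [pow_zero, Matrix.one_apply] at h1 h2 ⊢
    split_ifs at h1 h2 with ha hb
    · rw [if_pos (Prod.ext ha hb)]; exact one_pos
    all_goals exact absurd ‹(0 : ℝ) < 0› (lt_irrefl _)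
  | succ n ih =>
    rw [pow_succ', Matrix.mul_apply] at h1 h2 ⊢
    have key : ∀ {A : Matrix E E ℝ} {x x' : E}, (∀ i j, 0 ≤ A i j) →
        0 < ∑ w, A x w * (A ^ n) w x' → ∃ w, 0 < A x w ∧ 0 < (A ^ n) w x' := by
      intro A x x' hA h
      obtain ⟨w, -, hw⟩ := Finset.exists_ne_zero_of_sum_ne_zero h.ne'
      exact ⟨w, (hA _ _).lt_of_ne' (left_ne_zero_of_mul hw),
        (pow_apply_nonneg hA n _ _).lt_of_ne' (right_ne_zero_of_mul hw)⟩
    obtain ⟨x, hx1, hx2⟩ := key hP h1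
    obtain ⟨y, hy1, hy2⟩ := key hQ h2
    have hnn := Phi_nonneg hP hQ f θ
    exact Finset.sum_pos' (fun w _ => mul_nonneg (hnn _ _) (pow_apply_nonneg hnn n _ _))
      ⟨(x, y), Finset.mem_univ _, mul_pos ((Phi_pos_iff hP hQ f θ _ _).2 ⟨hx1, hy1⟩)
        (ih _ hx2 hy2)⟩

theorem Phi_isPrimitive (hP : P.IsIrreducible) (hQ : Q.IsIrreducible) (hPap : IsAperiodic P)
    (hQap : IsAperiodic Q) (f : E → E → ℤ) (θ : ℝ) : (Phi P Q f θ).IsPrimitive := by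
  obtain ⟨N, hN⟩ := exists_forall_pow_pos hP hPap
  obtain ⟨M, hM⟩ := exists_forall_pow_pos hQ hQap
  exact ⟨Phi_nonneg hP.nonneg hQ.nonneg f θ, N + M + 1, by omega, fun z z' =>
    Phi_pow_pos hP.nonneg hQ.nonneg f θ _ z z' (hN _ (by omega) _ _) (hM _ (by omega) _ _)⟩

lemma continuous_Phi_pow (P Q : Matrix E E ℝ) (f : E → E → ℤ) (n : ℕ) (z z' : E × E) :
    Continuous fun θ => (Phi P Q f θ ^ n) z z' := by
  have h : Continuous fun θ => Phi P Q f θ := by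
    refine continuous_matrix fun z z' => ?_
    simp only [Phi, Matrix.of_apply]
    fun_prop
  exact (h.pow n).matrix_elem z z'

lemma prodMatrix_mem {A B : Matrix E E ℝ} (hA : A ∈ rowStochastic ℝ E)
    (hB : B ∈ rowStochastic ℝ E) :
    prodMatrix A B ∈ rowStochastic ℝ (E × E) := by
  rw [mem_rowStochastic_iff_sum]
  refine ⟨fun z z' => mul_nonneg (hA.1 _ _) (hB.1 _ _), fun z => ?_⟩
  simp only [prodMatrix, Matrix.of_apply, Fintype.sum_prod_type, ← Finset.mul_sum,
    sum_row_of_mem_rowStochastic hB, mul_one, sum_row_of_mem_rowStochastic hA]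

lemma Phi_zero_mem (hP : P ∈ rowStochastic ℝ E) (hQ : Q ∈ rowStochastic ℝ E)
    (f : E → E → ℤ) : Phi P Q f 0 ∈ rowStochastic ℝ (E × E) := by
  rw [Phi_zero_eq]; exact prodMatrix_mem hP hQ

/-- The row sums of `Φ(θ)ⁿ` are the exponential moments of `f(Z₁) + ⋯ + f(Zₙ)` for the product
chain, so their derivatives at `0` are the expectations of these sums. -/
lemma hasDerivAt_Phi_pow (hP : P ∈ rowStochastic ℝ E) (hQ : Q ∈ rowStochastic ℝ E)
    (f : E → E → ℤ) (n : ℕ) (z : E × E) :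
    HasDerivAt (fun θ => (Phi P Q f θ ^ n *ᵥ 1) z)
      (∑ k ∈ Finset.range n, (Phi P Q f 0 ^ (k + 1) *ᵥ fun w => (f w.1 w.2 : ℝ)) z) 0 := by
  induction n generalizing z with
  | zero => simpa using hasDerivAt_const (0 : ℝ) (1 : ℝ)
  | succ n ih =>
    have hval : Phi P Q f 0 ^ n *ᵥ 1 = 1 := (pow_mem (Phi_zero_mem hP hQ f) n).2
    have hPhi : ∀ w, HasDerivAt (fun θ => Phi P Q f θ z w)
        ((f w.1 w.2 : ℝ) * Phi P Q f 0 z w) 0 := by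
      intro w
      have h1 : HasDerivAt (fun θ : ℝ => Real.exp (θ * (f w.1 w.2 : ℝ)))
          (f w.1 w.2 : ℝ) 0 := by
        simpa using ((hasDerivAt_id (0 : ℝ)).mul_const (f w.1 w.2 : ℝ)).exp
      simpa [Phi, mul_assoc] using h1.mul_const (P z.1 w.1 * Q z.2 w.2)
    have hsum := HasDerivAt.fun_sum fun w (_ : w ∈ Finset.univ) => (hPhi w).mul (ih w)
    simp only [pow_succ', ← Matrix.mulVec_mulVec]
    refine hsum.congr_deriv ?_
    rw [hval, Finset.sum_range_succ', Finset.sum_add_distrib, add_comm]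
    congr 1
    · simp only [Matrix.mulVec, dotProduct, Finset.mul_sum]
      rw [Finset.sum_comm]
    · simp [Matrix.mulVec, dotProduct, mul_comm, Matrix.one_apply]

/-- Negative drift gives `φ(θ) < 1` for some `θ > 0`. -/
lemma exists_phi_lt_one [Nonempty E] (hP : P ∈ rowStochastic ℝ E) (hQ : Q ∈ rowStochastic ℝ E)
    (f : E → E → ℤ) (hprim : (Phi P Q f 0).IsPrimitive) {a b : E → ℝ}
    (ha : IsInvariantProb P a) (hb : IsInvariantProb Q b) (hμ : mean (prodVec a b) f < 0) :
    ∃ θ : ℝ, 0 < θ ∧ phi P Q f θ < 1 := by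
  have hinv : IsInvariantProb (Phi P Q f 0) (prodVec a b) := by
    rw [Phi_zero_eq]; exact isInvariantProb_prodVec ha hb
  have hces : ∀ z, Tendsto (fun n : ℕ => (n : ℝ)⁻¹ * ∑ k ∈ Finset.range n,
      (Phi P Q f 0 ^ (k + 1) *ᵥ fun w => (f w.1 w.2 : ℝ)) z) atTop
      (𝓝 (mean (prodVec a b) f)) := by
    intro z
    refine Tendsto.cesaro ?_
    refine (tendsto_add_atTop_iff_nat (f := fun k : ℕ =>
      (Phi P Q f 0 ^ k *ᵥ fun w => (f w.1 w.2 : ℝ)) z) 1).2 ?_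
    refine tendsto_finsetSum _ fun w _ => ?_
    rw [mul_comm]
    exact (tendsto_pow_apply (Phi_zero_mem hP hQ f) hprim hinv z w).mul_const _
  have hev : ∀ᶠ n : ℕ in atTop, ∀ z, (n : ℝ)⁻¹ * ∑ k ∈ Finset.range n,
      (Phi P Q f 0 ^ (k + 1) *ᵥ fun w => (f w.1 w.2 : ℝ)) z < 0 :=
    eventually_all.2 fun z => (hces z).eventually_lt_const hμ
  obtain ⟨n, hn, hn0⟩ := (hev.and (eventually_ne_atTop 0)).exists
  have hval : Phi P Q f 0 ^ n *ᵥ 1 = 1 := (pow_mem (Phi_zero_mem hP hQ f) n).2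
  -- `Φ(θ)ⁿ 1` equals `1` at `θ = 0` and has negative derivative there.
  have hlt : ∀ᶠ θ in 𝓝[>] (0 : ℝ), ∀ z, (Phi P Q f θ ^ n *ᵥ 1) z < 1 := by
    refine eventually_all.2 fun z => ?_
    have hd := hasDerivAt_iff_tendsto_slope.1 (hasDerivAt_Phi_pow hP hQ f n z)
    have hneg := neg_of_mul_neg_right (hn z) (by positivity)
    have h1 := (hd.mono_left (nhdsWithin_mono 0 fun θ (hθ : 0 < θ) => hθ.ne')).eventually_lt_const
      hneg
    filter_upwards [h1, self_mem_nhdsWithin] with θ hθ hθ0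
    rw [slope_def_field, hval, div_lt_iff₀ (by simpa using hθ0)] at hθ
    simpa using hθ
  obtain ⟨θ, hθ, hθ0⟩ := (hlt.and self_mem_nhdsWithin).exists
  refine ⟨θ, hθ0, (spectralRadius_lt_one_iff (Phi_nonneg hP.1 hQ.1 f θ)).2 ⟨n, hn0, fun z => ?_⟩⟩
  simpa [Matrix.mulVec, dotProduct] using hθ z

lemma sum_range_succ_eq_of_periodic {M : Type*} [AddCancelCommMonoid M] {g : ℕ → M} {n : ℕ}
    (hg : g n = g 0) : ∑ k ∈ Finset.range n, g (k + 1) = ∑ k ∈ Finset.range n, g k := by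
  have h := (Finset.sum_range_succ' g n).symm.trans (Finset.sum_range_succ g n)
  rw [hg] at h
  exact add_right_cancel h

/-- A single path from `(x₀, y₀)` to `(xₙ, yₙ)` bounds the entry of `Φ(θ)ⁿ` from below. -/
lemma exp_mul_prod_le_Phi_pow (hP : ∀ i j, 0 ≤ P i j) (hQ : ∀ i j, 0 ≤ Q i j) (f : E → E → ℤ)
    (θ : ℝ) (x y : ℕ → E) (n : ℕ) :
    Real.exp (θ * ∑ k ∈ Finset.range n, (f (x (k + 1)) (y (k + 1)) : ℝ)) *
      ∏ k ∈ Finset.range n, (P (x k) (x (k + 1)) * Q (y k) (y (k + 1)))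
      ≤ (Phi P Q f θ ^ n) (x 0, y 0) (x n, y n) := by
  induction n with
  | zero => simp
  | succ n ih =>
    have hnn := Phi_nonneg hP hQ f θ
    have h1 := mul_le_pow_add hnn n 1 (x 0, y 0) (x n, y n) (x (n + 1), y (n + 1))
    refine le_trans ?_ h1
    rw [pow_one, Finset.sum_range_succ, Finset.prod_range_succ, mul_add, Real.exp_add]
    refine le_trans (le_of_eq ?_) (mul_le_mul_of_nonneg_right ih (hnn _ _))
    simp only [Phi, Matrix.of_apply]
    ring

/-- A cycle of positive weight gives `φ(θ) > 1` for some `θ > 0`. -/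
lemma exists_one_lt_phi [Nonempty E] (f : E → E → ℤ)
    (hprim : ∀ θ, (Phi P Q f θ).IsPrimitive) (hP : ∀ i j, 0 ≤ P i j) (hQ : ∀ i j, 0 ≤ Q i j)
    (hpos : HasPositiveCycle P Q f) :
    ∃ θ : ℝ, 0 < θ ∧ 1 < phi P Q f θ := by
  obtain ⟨n, hn, x, y, hx, hy, hsum⟩ := hpos
  have hx0 : x n = x 0 := by simpa using hx.1 0
  have hy0 : y n = y 0 := by simpa using hy.1 0
  set s : ℝ := ∑ k ∈ Finset.range n, (f (x (k + 1)) (y (k + 1)) : ℝ) with hs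
  have hs0 : 0 < s := by
    rw [hs, sum_range_succ_eq_of_periodic (g := fun k => (f (x k) (y k) : ℝ)) (by simp [hx0, hy0])]
    exact_mod_cast hsum
  set c := ∏ k ∈ Finset.range n, (P (x k) (x (k + 1)) * Q (y k) (y (k + 1)))
  have hc : 0 < c := Finset.prod_pos fun k _ => mul_pos (hx.2 k) (hy.2 k)
  have hlim : Tendsto (fun θ : ℝ => Real.exp (θ * s) * c) atTop atTop :=
    (Real.tendsto_exp_atTop.comp (tendsto_id.atTop_mul_const hs0)).atTop_mul_const hc
  obtain ⟨θ, hθ, hθ0⟩ := ((hlim.eventually_gt_atTop 1).and (eventually_gt_atTop 0)).exists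
  refine ⟨θ, hθ0, (one_lt_spectralRadius_iff (hprim θ).isIrreducible).2
    ⟨n, by omega, (x 0, y 0), hθ.trans_le ?_⟩⟩
  have := exp_mul_prod_le_Phi_pow hP hQ f θ x y n
  rwa [hx0, hy0] at this

/-- Both `{φ < 1}` and `{φ > 1}` are open since they are described by entries of powers of `Φ(θ)`;
as both meet the positive half-line, `φ` takes the value `1` there. -/
theorem exists_phi_eq_one [Nonempty E] (hP : P ∈ rowStochastic ℝ E) (hQ : Q ∈ rowStochastic ℝ E)
    (f : E → E → ℤ) (hprim : ∀ θ, (Phi P Q f θ).IsPrimitive) {a b : E → ℝ}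
    (ha : IsInvariantProb P a) (hb : IsInvariantProb Q b) (hμ : mean (prodVec a b) f < 0)
    (hpos : HasPositiveCycle P Q f) : ∃ θ : ℝ, 0 < θ ∧ phi P Q f θ = 1 := by
  have hU : IsOpen {θ | phi P Q f θ < 1} := by
    refine isOpen_iff_eventually.2 fun θ hθ => ?_
    obtain ⟨n, hn0, hn⟩ := (spectralRadius_lt_one_iff (Phi_nonneg hP.1 hQ.1 f θ)).1 hθ
    have hev := eventually_all.2 fun z => (continuous_finsetSum Finset.univ fun w _ =>
      continuous_Phi_pow P Q f n z w).continuousAt.eventually_lt_const (hn z)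
    filter_upwards [hev] with θ' h
    exact (spectralRadius_lt_one_iff (Phi_nonneg hP.1 hQ.1 f θ')).2 ⟨n, hn0, h⟩
  have hV : IsOpen {θ | 1 < phi P Q f θ} := by
    refine isOpen_iff_eventually.2 fun θ hθ => ?_
    obtain ⟨n, hn0, z, hz⟩ := (one_lt_spectralRadius_iff (hprim θ).isIrreducible).1 hθ
    filter_upwards [(continuous_Phi_pow P Q f n z z).continuousAt.eventually_const_lt hz] with θ' h
    exact (one_lt_spectralRadius_iff (hprim θ').isIrreducible).2 ⟨n, hn0, z, h⟩
  by_contra! hcon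
  obtain ⟨θ, -, h1, h2⟩ := isPreconnected_Ioi (a := (0 : ℝ)) _ _ hU hV
    (fun θ hθ => lt_or_gt_of_ne (hcon θ hθ))
    (exists_phi_lt_one hP hQ f (hprim 0) ha hb hμ)
    (exists_one_lt_phi f hprim hP.1 hQ.1 hpos)
  exact lt_asymm (show phi P Q f θ < 1 from h1) h2

end

/-! ### The tilted chain and its shifted means -/

section Tilting

variable {E : Type*} [Fintype E] [DecidableEq E] {P Q : Matrix E E ℝ} {f : E → E → ℤ} {θ : ℝ}
  {u : E × E → ℝ}

lemma tiltedMatrix_mem (hP : ∀ i j, 0 ≤ P i j) (hQ : ∀ i j, 0 ≤ Q i j)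
    (hu : ∀ z, 0 < u z) (heig : Phi P Q f θ *ᵥ u = u) :
    tiltedMatrix P Q f θ u ∈ rowStochastic ℝ (E × E) := by
  rw [mem_rowStochastic_iff_sum]
  refine ⟨fun z z' => mul_nonneg (div_pos (hu _) (hu _)).le (Phi_nonneg hP hQ f θ z z'),
    fun z => ?_⟩
  have h := congrFun heig z
  simp only [Matrix.mulVec, dotProduct] at h
  simp only [tiltedMatrix, Matrix.of_apply, div_mul_eq_mul_div, ← Finset.sum_div]
  rw [div_eq_one_iff_eq (hu z).ne', ← h]
  exact Finset.sum_congr rfl fun w _ => mul_comm _ _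

lemma tiltedMatrix_pow_apply (hu : ∀ z, 0 < u z) (n : ℕ) (z z' : E × E) :
    (tiltedMatrix P Q f θ u ^ n) z z' = u z' / u z * (Phi P Q f θ ^ n) z z' := by
  induction n generalizing z' with
  | zero =>
    rcases eq_or_ne z z' with rfl | h
    · simp [(hu z).ne']
    · simp [h]
  | succ n ih =>
    rw [pow_succ, pow_succ, Matrix.mul_apply, Matrix.mul_apply, Finset.mul_sum]
    refine Finset.sum_congr rfl fun w _ => ?_
    rw [ih, tiltedMatrix, Matrix.of_apply]
    have := (hu w).ne'
    have := (hu z).ne'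
    field_simp

lemma tiltedMatrix_isPrimitive (hprim : (Phi P Q f θ).IsPrimitive) (hu : ∀ z, 0 < u z) :
    (tiltedMatrix P Q f θ u).IsPrimitive := by
  obtain ⟨k, hk0, hk⟩ := hprim.exists_pos_pow
  refine ⟨fun z z' => mul_nonneg (div_pos (hu _) (hu _)).le (hprim.nonneg z z'), k, hk0,
    fun z z' => ?_⟩
  rw [tiltedMatrix_pow_apply hu]
  exact mul_pos (div_pos (hu _) (hu _)) (hk z z')

/-- The eigenvector in the tilting data is unique up to scaling: the ratio of two eigenvectors is
harmonic for the tilted chain. Hence the tilted matrix does not depend on its choice. -/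
lemma tiltedMatrix_eq [Nonempty E] (hprim : (Phi P Q f θ).IsPrimitive)
    (hR : tiltedMatrix P Q f θ u ∈ rowStochastic ℝ (E × E)) (hu : ∀ z, 0 < u z)
    {r : E × E → ℝ} (hr0 : r ≠ 0) (hr : Phi P Q f θ *ᵥ r = r) :
    tiltedMatrix P Q f θ r = tiltedMatrix P Q f θ u := by
  have hharm : tiltedMatrix P Q f θ u *ᵥ (fun z => r z / u z) = fun z => r z / u z := by
    funext z
    have h := congrFun hr z
    simp only [Matrix.mulVec, dotProduct] at h
    simp only [Matrix.mulVec, dotProduct, tiltedMatrix, Matrix.of_apply]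
    rw [← h, Finset.sum_div]
    refine Finset.sum_congr rfl fun w _ => ?_
    have := (hu w).ne'
    have := (hu z).ne'
    field_simp
  have hconst := harmonic_eq hR (tiltedMatrix_isPrimitive hprim hu) hharm
  obtain ⟨z₀, hz₀⟩ := Function.ne_iff.1 hr0
  set c := r z₀ / u z₀ with hc
  have hc0 : c ≠ 0 := div_ne_zero hz₀ (hu z₀).ne'
  have hrc : ∀ z, r z = c * u z := fun z => by
    rw [hc, ← hconst z z₀, div_mul_cancel₀ _ (hu z).ne']
  ext z z'
  simp only [tiltedMatrix, Matrix.of_apply, hrc, mul_div_mul_left _ _ hc0]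

end Tilting

section PathSum

variable {S : Type*} [Fintype S] [DecidableEq S]

/-- Summing path weights over the intermediate states gives the entries of `R ^ T`. -/
lemma sum_path_eq (R : Matrix S S ℝ) (T : ℕ) (g : S → S → ℝ) :
    ∑ p : Fin (T + 1) → S, g (p 0) (p (Fin.last T)) * ∏ i : Fin T, R (p i.castSucc) (p i.succ)
      = ∑ z, ∑ z', g z z' * (R ^ T) z z' := by
  induction T generalizing g with
  | zero =>
    rw [← (Equiv.funUnique (Fin 1) S).symm.sum_comp]
    simp [Matrix.one_apply]
  | succ T ih =>
    rw [← (Fin.consEquiv fun _ => S).sum_comp, Fintype.sum_prod_type]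
    refine Finset.sum_congr rfl fun z _ => ?_
    have h := ih fun w z' => g z z' * R z w
    rw [Finset.sum_comm] at h
    simp only [pow_succ', Matrix.mul_apply, Finset.mul_sum, ← mul_assoc]
    rw [← h]
    refine Finset.sum_congr rfl fun w _ => ?_
    rw [Fin.prod_univ_succ]
    simp [Fin.consEquiv, ← Fin.succ_last, mul_assoc]

end PathSum

section Shifted

variable {E : Type*} [Fintype E]

lemma shiftedMean_eq [DecidableEq E] (ν : E × E → ℝ) (R : Matrix (E × E) (E × E) ℝ)
    (f : E → E → ℤ) (T : ℕ) :
    shiftedMean ν R f T = ∑ z, ∑ z', (f z.1 z'.2 : ℝ) * ν z * (R ^ T) z z' := by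
  rw [← sum_path_eq R T fun z z' => (f z.1 z'.2 : ℝ) * ν z]
  exact Finset.sum_congr rfl fun z _ => by rw [pathProb, mul_assoc]

lemma mean_prodVec_marg (ν ν' : E × E → ℝ) (f : E → E → ℤ) :
    mean (prodVec (marg₁ ν) (marg₂ ν')) f = ∑ z, ∑ z', (f z.1 z'.2 : ℝ) * ν z * ν' z' := by
  have h : ∀ x y', (f x y' : ℝ) * (marg₁ ν x * marg₂ ν' y')
      = ∑ y, ∑ x', (f x y' : ℝ) * ν (x, y) * ν' (x', y') := fun x y' => by
    rw [marg₁, marg₂, Finset.sum_mul_sum, Finset.mul_sum]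
    simp only [Finset.mul_sum, mul_assoc]
  simp only [mean, prodVec, Fintype.sum_prod_type, h]
  refine Finset.sum_congr rfl fun x _ => ?_
  rw [Finset.sum_comm]
  exact Finset.sum_congr rfl fun y _ => Finset.sum_comm

theorem tendsto_shiftedMean [DecidableEq E] [Nonempty E] {R : Matrix (E × E) (E × E) ℝ}
    (hR : R ∈ rowStochastic ℝ (E × E)) (hprim : R.IsPrimitive) {ν : E × E → ℝ}
    (hν : IsInvariantProb R ν) (f : E → E → ℤ) :
    Tendsto (fun T => shiftedMean ν R f T) atTop
      (𝓝 (mean (prodVec (marg₁ ν) (marg₂ ν)) f)) := by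
  simp only [shiftedMean_eq, mean_prodVec_marg]
  exact tendsto_finsetSum _ fun z _ => tendsto_finsetSum _ fun z' _ =>
    (tendsto_pow_apply hR hprim hν z z').const_mul _

end Shifted

/-! ### Gibbs' inequality and images of stationary chains -/

section Gibbs

variable {S : Type*} [Fintype S]

lemma mul_log_sub_le {p q : ℝ} (hp : 0 ≤ p) (hq : 0 ≤ q) (hpq : 0 < p → 0 < q) :
    p * (Real.log q - Real.log p) ≤ q - p ∧
      (p * (Real.log q - Real.log p) = q - p → p = q) := by
  rcases hp.eq_or_lt with rfl | hp0
  · simp only [zero_mul, sub_zero]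
    exact ⟨hq, id⟩
  · have hq0 := hpq hp0
    rw [← Real.log_div hq0.ne' hp0.ne']
    have hmul : p * (q / p - 1) = q - p := by field_simp
    rcases eq_or_ne (q / p) 1 with h1 | h1
    · have : q = p := by rwa [div_eq_one_iff_eq hp0.ne'] at h1
      subst this
      simp [hp0.ne']
    · have hlt := mul_lt_mul_of_pos_left
        (Real.log_lt_sub_one_of_pos (div_pos hq0 hp0) h1) hp0
      rw [hmul] at hlt
      exact ⟨hlt.le, fun h => absurd h hlt.ne⟩

/-- Gibbs' inequality for the rows of two stochastic matrices `G` and `R`, averaged over a weight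
`m`: the conditional relative entropy is nonnegative. -/
lemma sum_mul_log_sub_le [DecidableEq S] {m : S → ℝ} {G R : Matrix S S ℝ} (hm : ∀ z, 0 ≤ m z)
    (hG : G ∈ rowStochastic ℝ S) (hR : R ∈ rowStochastic ℝ S)
    (hGR : ∀ z z', 0 < G z z' → 0 < R z z') :
    ∑ z, ∑ z', m z * G z z' * (Real.log (R z z') - Real.log (G z z')) ≤ 0 := by
  refine Finset.sum_nonpos fun z _ => ?_
  calc ∑ z', m z * G z z' * (Real.log (R z z') - Real.log (G z z'))
      ≤ ∑ z', m z * (R z z' - G z z') := Finset.sum_le_sum fun z' _ => by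
        rw [mul_assoc]
        exact mul_le_mul_of_nonneg_left
          (mul_log_sub_le (hG.1 z z') (hR.1 z z') (hGR z z')).1 (hm z)
    _ = 0 := by
        rw [← Finset.mul_sum, Finset.sum_sub_distrib, sum_row_of_mem_rowStochastic hG,
          sum_row_of_mem_rowStochastic hR, sub_self, mul_zero]

lemma eq_of_sum_mul_log_sub_eq_zero [DecidableEq S] {m : S → ℝ} {G R : Matrix S S ℝ}
    (hm : ∀ z, 0 < m z) (hG : G ∈ rowStochastic ℝ S) (hR : R ∈ rowStochastic ℝ S)
    (hGR : ∀ z z', 0 < G z z' → 0 < R z z')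
    (h : ∑ z, ∑ z', m z * G z z' * (Real.log (R z z') - Real.log (G z z')) = 0) : G = R := by
  have hle : ∀ z z', m z * G z z' * (Real.log (R z z') - Real.log (G z z'))
      ≤ m z * (R z z' - G z z') := fun z z' => by
    rw [mul_assoc]
    exact mul_le_mul_of_nonneg_left
      (mul_log_sub_le (hG.1 z z') (hR.1 z z') (hGR z z')).1 (hm z).le
  have hzero : ∑ z, ∑ z', m z * (R z z' - G z z') = 0 := by
    simp only [← Finset.mul_sum, Finset.sum_sub_distrib, sum_row_of_mem_rowStochastic hG,
      sum_row_of_mem_rowStochastic hR, sub_self, mul_zero, Finset.sum_const_zero]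
  rw [← hzero] at h
  ext z z'
  have h1 := (Finset.sum_eq_sum_iff_of_le fun z _ => Finset.sum_le_sum fun z' _ => hle z z').1 h z
    (Finset.mem_univ z)
  have h2 := (Finset.sum_eq_sum_iff_of_le fun z' _ => hle z z').1 h1 z' (Finset.mem_univ z')
  rw [mul_assoc] at h2
  exact (mul_log_sub_le (hG.1 z z') (hR.1 z z') (hGR z z')).2 (mul_left_cancel₀ (hm z).ne' h2)

lemma sum_sum_mul_target {m : S → ℝ} {G : Matrix S S ℝ} (hm : m ᵥ* G = m) (g : S → ℝ) :
    ∑ z, ∑ z', m z * G z z' * g z' = ∑ z, m z * g z := by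
  rw [Finset.sum_comm]
  refine Finset.sum_congr rfl fun z' _ => ?_
  rw [← Finset.sum_mul]
  exact congrArg (· * g z') (congrFun hm z')

lemma sum_sum_mul_source [DecidableEq S] {m : S → ℝ} {G : Matrix S S ℝ}
    (hG : G ∈ rowStochastic ℝ S) (g : S → ℝ) :
    ∑ z, ∑ z', m z * G z z' * g z = ∑ z, m z * g z := by
  refine Finset.sum_congr rfl fun z _ => ?_
  rw [← Finset.sum_mul, ← Finset.mul_sum, sum_row_of_mem_rowStochastic hG, mul_one]

end Gibbs

section Lumping

variable {S E : Type*} [Fintype S] [DecidableEq E]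

/-- The transition probabilities `P(π(Z₁) = x' | π(Z₀) = x)` of the image under `π` of a stationary
chain with transition matrix `R` and initial distribution `ν`. The image process need not be a
Markov chain. -/
noncomputable def imageMatrix (π : S → E) (ν : S → ℝ) (R : Matrix S S ℝ) : Matrix E E ℝ :=
  Matrix.of fun x x' =>
    (∑ z with π z = x, ∑ z' with π z' = x', ν z * R z z') / ∑ z with π z = x, ν z

variable {π : S → E} {ν : S → ℝ} {R : Matrix S S ℝ}

lemma sum_fiber_pos (hπ : π.Surjective) (hν : ∀ z, 0 < ν z) (x : E) :
    0 < ∑ z with π z = x, ν z := by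
  obtain ⟨z, hz⟩ := hπ x
  exact Finset.sum_pos (fun z _ => hν z) ⟨z, by simp [hz]⟩

lemma sum_fiber_mul_imageMatrix (hπ : π.Surjective) (hν : ∀ z, 0 < ν z) (x x' : E) :
    (∑ z with π z = x, ν z) * imageMatrix π ν R x x'
      = ∑ z with π z = x, ∑ z' with π z' = x', ν z * R z z' :=
  mul_div_cancel₀ _ (sum_fiber_pos hπ hν x).ne'

lemma imageMatrix_pos_iff (hπ : π.Surjective) (hν : ∀ z, 0 < ν z) (hR : ∀ z z', 0 ≤ R z z')
    (x x' : E) : 0 < imageMatrix π ν R x x' ↔ ∃ z z', π z = x ∧ π z' = x' ∧ 0 < R z z' := by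
  have hnn : ∀ z z', 0 ≤ ν z * R z z' := fun z z' => mul_nonneg (hν z).le (hR z z')
  rw [imageMatrix, Matrix.of_apply, div_pos_iff_of_pos_right (sum_fiber_pos hπ hν x),
    Finset.sum_pos_iff_of_nonneg fun z _ => Finset.sum_nonneg fun z' _ => hnn z z']
  simp [Finset.sum_pos_iff_of_nonneg fun z' _ => hnn _ z', mul_pos_iff_of_pos_left (hν _)]

variable [Fintype E]

lemma sum_imageMatrix_mul (hπ : π.Surjective) (hν : ∀ z, 0 < ν z) (g : E → E → ℝ) :
    ∑ x, ∑ x', (∑ z with π z = x, ν z) * imageMatrix π ν R x x' * g x x'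
      = ∑ z, ∑ z', ν z * R z z' * g (π z) (π z') := by
  simp only [sum_fiber_mul_imageMatrix hπ hν, Finset.sum_mul]
  rw [← Finset.sum_fiberwise _ π]
  refine Finset.sum_congr rfl fun x _ => ?_
  rw [Finset.sum_comm]
  refine Finset.sum_congr rfl fun z hz => ?_
  rw [← Finset.sum_fiberwise _ π fun z' => ν z * R z z' * g (π z) (π z')]
  refine Finset.sum_congr rfl fun x' _ => Finset.sum_congr rfl fun z' hz' => ?_
  rw [(Finset.mem_filter.1 hz).2, (Finset.mem_filter.1 hz').2]

lemma imageMatrix_mem [DecidableEq S] (hπ : π.Surjective) (hν : ∀ z, 0 < ν z)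
    (hR : R ∈ rowStochastic ℝ S) : imageMatrix π ν R ∈ rowStochastic ℝ E := by
  rw [mem_rowStochastic_iff_sum]
  refine ⟨fun x x' => div_nonneg (Finset.sum_nonneg fun z _ => Finset.sum_nonneg fun z' _ =>
    mul_nonneg (hν z).le (hR.1 z z')) (sum_fiber_pos hπ hν x).le, fun x => ?_⟩
  simp only [imageMatrix, Matrix.of_apply, ← Finset.sum_div]
  rw [div_eq_one_iff_eq (sum_fiber_pos hπ hν x).ne', Finset.sum_comm]
  refine Finset.sum_congr rfl fun z _ => ?_
  rw [Finset.sum_fiberwise, ← Finset.mul_sum, sum_row_of_mem_rowStochastic hR, mul_one]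

lemma imageMatrix_invariant (hπ : π.Surjective) (hν : ∀ z, 0 < ν z)
    (hinv : IsInvariantProb R ν) :
    IsInvariantProb (imageMatrix π ν R) fun x => ∑ z with π z = x, ν z := by
  refine ⟨⟨fun x => (sum_fiber_pos hπ hν x).le, ?_⟩, ?_⟩
  · rw [Finset.sum_fiberwise, hinv.1.2]
  · funext x'
    simp only [Matrix.vecMul, dotProduct, sum_fiber_mul_imageMatrix hπ hν]
    rw [Finset.sum_fiberwise, Finset.sum_comm]
    exact Finset.sum_congr rfl fun z' _ => congrFun hinv.2 z'

end Lumping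

/-! ### Comparison of the tilted chain with decoupled chains -/

section Comparison

variable {E : Type*} {P Q A B : Matrix E E ℝ} {a b : E → ℝ} {f : E → E → ℤ} {θ : ℝ}
  {u ν : E × E → ℝ}

lemma log_tiltedMatrix_sub (hu : ∀ z, 0 < u z) {z z' : E × E} (hP : 0 < P z.1 z'.1)
    (hQ : 0 < Q z.2 z'.2) (hA : 0 < A z.1 z'.1) (hB : 0 < B z.2 z'.2) :
    Real.log (tiltedMatrix P Q f θ u z z') - Real.log (prodMatrix A B z z')
      = θ * f z'.1 z'.2 + Real.log (u z') - Real.log (u z)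
        - ((Real.log (A z.1 z'.1) - Real.log (P z.1 z'.1))
          + (Real.log (B z.2 z'.2) - Real.log (Q z.2 z'.2))) := by
  have h1 := (hu z).ne'
  have h2 := (hu z').ne'
  have h3 := Real.exp_ne_zero (θ * (f z'.1 z'.2 : ℝ))
  simp only [tiltedMatrix, Phi, prodMatrix, Matrix.of_apply]
  rw [Real.log_mul (div_ne_zero h2 h1) (by positivity), Real.log_div h2 h1,
    Real.log_mul (by positivity) hQ.ne', Real.log_mul h3 hP.ne', Real.log_exp,
    Real.log_mul hA.ne' hB.ne']
  ring

/-- If `θ f` splits, up to a coboundary, into a function of the transitions of the first and one of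
the transitions of the second coordinate, then its sum over a pair of cycles does not change when
one of them is shifted. -/
lemma not_hasShiftSensitiveCycles (hθ : θ ≠ 0) {h : E × E → ℝ} {α β : E → E → ℝ}
    (hsplit : ∀ z z' : E × E, 0 < P z.1 z'.1 → 0 < Q z.2 z'.2 →
      θ * f z'.1 z'.2 + h z' - h z = α z.1 z'.1 + β z.2 z'.2) :
    ¬ HasShiftSensitiveCycles P Q f := by
  intro hshift
  -- Shifts by one suffice.
  obtain ⟨n, -, x, y, hx, hy, hne⟩ := hshift 1 le_rfl
  have key : ∀ y : ℕ → E, IsCycle Q n y → θ * ∑ k ∈ Finset.range n, (f (x k) (y k) : ℝ)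
      = ∑ k ∈ Finset.range n, α (x k) (x (k + 1))
        + ∑ k ∈ Finset.range n, β (y k) (y (k + 1)) := by
    intro y hy
    have hx0 : x n = x 0 := by simpa using hx.1 0
    have hy0 : y n = y 0 := by simpa using hy.1 0
    have h1 := sum_range_succ_eq_of_periodic (g := fun k => (f (x k) (y k) : ℝ)) (n := n)
      (by simp [hx0, hy0])
    have h2 := sum_range_succ_eq_of_periodic (g := fun k => h (x k, y k)) (n := n)
      (by simp [hx0, hy0])
    have h3 := Finset.sum_congr (rfl : Finset.range n = Finset.range n) fun k _ =>
      hsplit (x k, y k) (x (k + 1), y (k + 1)) (hx.2 k) (hy.2 k)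
    simp only [Finset.sum_add_distrib, Finset.sum_sub_distrib, ← Finset.mul_sum, h1, h2] at h3
    linarith
  have hy' : IsCycle Q n fun k => y (k + 1) :=
    ⟨fun k => by simpa [add_right_comm] using hy.1 (k + 1), fun k => hy.2 (k + 1)⟩
  have h4 := sum_range_succ_eq_of_periodic (g := fun k => β (y k) (y (k + 1))) (n := n) (by
    have h0 := hy.1 0
    have h1 := hy.1 1
    simp only [zero_add] at h0
    simp only [h0, zero_add, add_comm n 1, h1])
  have h5 := key _ hy
  rw [← h4, ← key _ hy'] at h5
  exact hne (by exact_mod_cast mul_left_cancel₀ hθ h5)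

variable [Fintype E] [DecidableEq E]

/-- A positive stationary chain `(A, a)` on `E` with the same possible transitions as `P`, such that
the expectation of `log (A / P)` over a transition is the same for `(A, a)` and for the image under
`π` of the chain `(R, ν)`. The two cases of interest are the image transition matrix of `(R, ν)`
under a coordinate projection, and `P` itself, for which the logarithm vanishes. -/
structure IsEntropyFactor (π : E × E → E) (ν : E × E → ℝ) (R : Matrix (E × E) (E × E) ℝ)
    (P A : Matrix E E ℝ) (a : E → ℝ) : Prop where
  mem : A ∈ rowStochastic ℝ E
  invariant : IsInvariantProb A a
  pos : ∀ x, 0 < a x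
  pos_iff : ∀ x x', 0 < A x x' ↔ 0 < P x x'
  sum_log : ∑ z, ∑ z', ν z * R z z' *
      (Real.log (A (π z) (π z')) - Real.log (P (π z) (π z')))
    = ∑ x, ∑ x', a x * A x x' * (Real.log (A x x') - Real.log (P x x'))

lemma isEntropyFactor_self (π : E × E → E) (ν : E × E → ℝ) (R : Matrix (E × E) (E × E) ℝ)
    (hP : P ∈ rowStochastic ℝ E) (ha : IsInvariantProb P a) (hpos : ∀ x, 0 < a x) :
    IsEntropyFactor π ν R P P a :=
  ⟨hP, ha, hpos, fun _ _ => Iff.rfl, by simp⟩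

lemma isEntropyFactor_imageMatrix {π : E × E → E} {R : Matrix (E × E) (E × E) ℝ}
    (hπ : π.Surjective) (hν : ∀ z, 0 < ν z)
    (hR : R ∈ rowStochastic ℝ (E × E)) (hinv : IsInvariantProb R ν)
    (hsupp : ∀ x x', (∃ z z', π z = x ∧ π z' = x' ∧ 0 < R z z') ↔ 0 < P x x') :
    IsEntropyFactor π ν R P (imageMatrix π ν R) fun x => ∑ z with π z = x, ν z :=
  ⟨imageMatrix_mem hπ hν hR, imageMatrix_invariant hπ hν hinv, sum_fiber_pos hπ hν,
    fun x x' => (imageMatrix_pos_iff hπ hν hR.1 x x').trans (hsupp x x'),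
    (sum_imageMatrix_mul hπ hν fun x x' =>
      Real.log (imageMatrix π ν R x x') - Real.log (P x x')).symm⟩

lemma marg₁_eq (ν : E × E → ℝ) : marg₁ ν = fun x => ∑ z with z.1 = x, ν z := by
  funext x
  simp [marg₁, Finset.sum_filter, Fintype.sum_prod_type_right]

lemma marg₂_eq (ν : E × E → ℝ) : marg₂ ν = fun y => ∑ z with z.2 = y, ν z := by
  funext x
  simp [marg₂, Finset.sum_filter, Fintype.sum_prod_type]

lemma sum_prodVec_prodMatrix_fst (hB : B ∈ rowStochastic ℝ E) (hb : ∑ y, b y = 1)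
    (g : E → E → ℝ) :
    ∑ z, ∑ z', prodVec a b z * prodMatrix A B z z' * g z.1 z'.1
      = ∑ x, ∑ x', a x * A x x' * g x x' := by
  simp only [Fintype.sum_prod_type, prodVec, prodMatrix, Matrix.of_apply]
  refine Finset.sum_congr rfl fun x _ => ?_
  rw [Finset.sum_comm]
  refine Finset.sum_congr rfl fun x' _ => ?_
  have h : ∀ y y', a x * b y * (A x x' * B y y') * g x x'
      = a x * A x x' * g x x' * (b y * B y y') := fun y y' => by ring
  simp only [h, ← Finset.mul_sum, sum_row_of_mem_rowStochastic hB, mul_one, hb]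

lemma sum_prodVec_prodMatrix_snd (hA : A ∈ rowStochastic ℝ E) (ha : ∑ x, a x = 1)
    (g : E → E → ℝ) :
    ∑ z, ∑ z', prodVec a b z * prodMatrix A B z z' * g z.2 z'.2
      = ∑ y, ∑ y', b y * B y y' * g y y' := by
  simp only [Fintype.sum_prod_type_right, prodVec, prodMatrix, Matrix.of_apply]
  refine Finset.sum_congr rfl fun y _ => ?_
  rw [Finset.sum_comm]
  refine Finset.sum_congr rfl fun y' _ => ?_
  have h : ∀ x x', a x * b y * (A x x' * B y y') * g y y'
      = b y * B y y' * g y y' * (a x * A x x') := fun x x' => by ring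
  simp only [h, ← Finset.mul_sum, sum_row_of_mem_rowStochastic hA, mul_one, ha]

/-- For a stationary chain `(K, k)`, the eigenvector terms in `log (R / (A ⊗ B))` telescope, and
what remains is the mean of `θ f` and the logarithms of `A / P` and `B / Q`. -/
lemma sum_mul_log_tiltedMatrix_sub (hu : ∀ z, 0 < u z) (hPnn : ∀ i j, 0 ≤ P i j)
    (hQnn : ∀ i j, 0 ≤ Q i j)
    (hA : ∀ x x', 0 < A x x' ↔ 0 < P x x') (hB : ∀ x x', 0 < B x x' ↔ 0 < Q x x')
    {K : Matrix (E × E) (E × E) ℝ} {k : E × E → ℝ} (hK : K ∈ rowStochastic ℝ (E × E))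
    (hk : IsInvariantProb K k) (hsupp : ∀ z z', 0 < K z z' → 0 < Phi P Q f θ z z') :
    ∑ z, ∑ z', k z * K z z' *
        (Real.log (tiltedMatrix P Q f θ u z z') - Real.log (prodMatrix A B z z'))
      = θ * mean k f
        - (∑ z, ∑ z', k z * K z z' * (Real.log (A z.1 z'.1) - Real.log (P z.1 z'.1))
          + ∑ z, ∑ z', k z * K z z' * (Real.log (B z.2 z'.2) - Real.log (Q z.2 z'.2))) := by
  have hterm : ∀ z z', k z * K z z' *
        (Real.log (tiltedMatrix P Q f θ u z z') - Real.log (prodMatrix A B z z'))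
      = k z * K z z' * (θ * f z'.1 z'.2) + k z * K z z' * Real.log (u z')
        - k z * K z z' * Real.log (u z)
        - (k z * K z z' * (Real.log (A z.1 z'.1) - Real.log (P z.1 z'.1))
          + k z * K z z' * (Real.log (B z.2 z'.2) - Real.log (Q z.2 z'.2))) := by
    intro z z'
    rcases (hK.1 z z').eq_or_lt with h0 | h0
    · simp [← h0]
    · obtain ⟨h1, h2⟩ := (Phi_pos_iff hPnn hQnn f θ z z').1 (hsupp z z' h0)
      rw [log_tiltedMatrix_sub hu h1 h2 ((hA _ _).2 h1) ((hB _ _).2 h2)]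
      ring
  simp only [hterm, Finset.sum_add_distrib, Finset.sum_sub_distrib]
  rw [sum_sum_mul_target hk.2 fun z' => Real.log (u z'),
    sum_sum_mul_source hK fun z => Real.log (u z),
    sum_sum_mul_target hk.2 fun z' => θ * (f z'.1 z'.2 : ℝ), mean, Finset.mul_sum]
  have : ∑ z, k z * (θ * (f z.1 z.2 : ℝ)) = ∑ z, θ * ((f z.1 z.2 : ℝ) * k z) :=
    Finset.sum_congr rfl fun z _ => by ring
  rw [this]
  ring

/-- Decoupling the coordinates of the tilted chain lowers the mean of `f`. With `G = A ⊗ B`, the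
relative entropies `H(R | G)` and `H(G | R)` are nonnegative; the first bounds the entropies of `A`
and `B` relative to `P` and `Q` by `θ` times the mean of `f` under `ν`, the second bounds `θ` times
the mean under `a ⊗ b` by the same entropies. Equality would force `R = A ⊗ B`. -/
theorem mean_prodVec_lt (hP : ∀ i j, 0 ≤ P i j) (hQ : ∀ i j, 0 ≤ Q i j)
    (hshift : HasShiftSensitiveCycles P Q f) (hθ : 0 < θ) (hu : ∀ z, 0 < u z)
    (hR : tiltedMatrix P Q f θ u ∈ rowStochastic ℝ (E × E))
    (hν : IsInvariantProb (tiltedMatrix P Q f θ u) ν)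
    (hA : IsEntropyFactor Prod.fst ν (tiltedMatrix P Q f θ u) P A a)
    (hB : IsEntropyFactor Prod.snd ν (tiltedMatrix P Q f θ u) Q B b) :
    mean (prodVec a b) f < mean ν f := by
  have hG := prodMatrix_mem hA.mem hB.mem
  have hm : IsInvariantProb (prodMatrix A B) (prodVec a b) :=
    isInvariantProb_prodVec hA.invariant hB.invariant
  have hRpos : ∀ z z', 0 < tiltedMatrix P Q f θ u z z' ↔ 0 < Phi P Q f θ z z' := fun z z' =>
    mul_pos_iff_of_pos_left (div_pos (hu z') (hu z))
  have hGpos : ∀ z z', 0 < prodMatrix A B z z' ↔ 0 < Phi P Q f θ z z' := by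
    intro z z'
    rw [Phi_pos_iff hP hQ, ← hA.pos_iff, ← hB.pos_iff]
    refine ⟨fun h => ?_, fun h => mul_pos h.1 h.2⟩
    exact ⟨pos_of_mul_pos_left h (hB.mem.1 _ _), pos_of_mul_pos_right h (hA.mem.1 _ _)⟩
  have h1 := sum_mul_log_sub_le (fun z => hm.1.1 z) hG hR
    fun z z' h => (hRpos z z').2 ((hGpos z z').1 h)
  have h1' := eq_of_sum_mul_log_sub_eq_zero (fun z => mul_pos (hA.pos z.1) (hB.pos z.2)) hG hR
    fun z z' h => (hRpos z z').2 ((hGpos z z').1 h)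
  have h2 := sum_mul_log_sub_le (fun z => hν.1.1 z) hR hG
    fun z z' h => (hGpos z z').2 ((hRpos z z').1 h)
  have e1 := sum_mul_log_tiltedMatrix_sub (f := f) (θ := θ) hu hP hQ hA.pos_iff hB.pos_iff hG hm
    fun z z' => (hGpos z z').1
  have e2 := sum_mul_log_tiltedMatrix_sub (f := f) (θ := θ) hu hP hQ hA.pos_iff hB.pos_iff hR hν
    fun z z' => (hRpos z z').1
  rw [hA.sum_log, hB.sum_log] at e2
  rw [sum_prodVec_prodMatrix_fst hB.mem hB.invariant.1.2
      fun x x' => Real.log (A x x') - Real.log (P x x'),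
    sum_prodVec_prodMatrix_snd hA.mem hA.invariant.1.2
      fun y y' => Real.log (B y y') - Real.log (Q y y')] at e1
  have h2' : 0 ≤ ∑ z, ∑ z', ν z * tiltedMatrix P Q f θ u z z' *
      (Real.log (tiltedMatrix P Q f θ u z z') - Real.log (prodMatrix A B z z')) := by
    rw [← neg_nonpos, ← Finset.sum_neg_distrib]
    refine le_of_eq_of_le (Finset.sum_congr rfl fun z _ => ?_) h2
    rw [← Finset.sum_neg_distrib]
    exact Finset.sum_congr rfl fun z' _ => by ring
  rw [e2] at h2'
  rcases h1.lt_or_eq with hlt | heq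
  · rw [e1] at hlt
    exact lt_of_mul_lt_mul_left (by linarith) hθ.le
  · exfalso
    have hGR := h1' heq
    refine not_hasShiftSensitiveCycles (P := P) (Q := Q) hθ.ne' (h := fun z => Real.log (u z))
      (α := fun x x' => Real.log (A x x') - Real.log (P x x'))
      (β := fun y y' => Real.log (B y y') - Real.log (Q y y')) (fun z z' hz1 hz2 => ?_) hshift
    have h3 := log_tiltedMatrix_sub (f := f) (θ := θ) hu hz1 hz2 ((hA.pos_iff _ _).2 hz1)
      ((hB.pos_iff _ _).2 hz2)
    rw [hGR, sub_self] at h3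
    linarith

end Comparison

end LocalAlignment

theorem lemma5p8 {E : Type*} [Fintype E] [DecidableEq E]
    (P Q : Matrix E E ℝ)
    (hP : P ∈ Matrix.rowStochastic ℝ E) (hQ : Q ∈ Matrix.rowStochastic ℝ E)
    (hPirr : P.IsIrreducible) (hQirr : Q.IsIrreducible)
    (hPap : LocalAlignment.IsAperiodic P) (hQap : LocalAlignment.IsAperiodic Q)
    (πP πQ : E → ℝ)
    (hπP : LocalAlignment.IsInvariantProb P πP) (hπQ : LocalAlignment.IsInvariantProb Q πQ)
    (f : E → E → ℤ)
    (hμ : LocalAlignment.mean (LocalAlignment.prodVec πP πQ) f < 0)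
    (hpos : LocalAlignment.HasPositiveCycle P Q f)
    (hshift : LocalAlignment.HasShiftSensitiveCycles P Q f) :
    (∃ (θ : ℝ) (r ν : E × E → ℝ), LocalAlignment.IsTilting P Q f θ r ν) ∧
    ∀ (θ : ℝ) (r ν : E × E → ℝ), LocalAlignment.IsTilting P Q f θ r ν →
      LocalAlignment.mean (LocalAlignment.prodVec (LocalAlignment.marg₁ ν) πQ) f
          < LocalAlignment.mean ν f ∧
      LocalAlignment.mean (LocalAlignment.prodVec πP (LocalAlignment.marg₂ ν)) f
          < LocalAlignment.mean ν f ∧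
      Tendsto
        (fun T : ℕ =>
          LocalAlignment.shiftedMean ν (LocalAlignment.tiltedMatrix P Q f θ r) f T)
        atTop
        (𝓝 (LocalAlignment.mean
          (LocalAlignment.prodVec (LocalAlignment.marg₁ ν) (LocalAlignment.marg₂ ν)) f)) ∧
      LocalAlignment.mean
          (LocalAlignment.prodVec (LocalAlignment.marg₁ ν) (LocalAlignment.marg₂ ν)) f
        < LocalAlignment.mean ν f := by
  open LocalAlignment in
  have hE : Nonempty E := by
    obtain ⟨n, -, x, -⟩ := hpos
    exact ⟨x 0⟩
  have hprim := Phi_isPrimitive hPirr hQirr hPap hQap f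
  constructor
  · obtain ⟨θ, hθ, hphi⟩ := exists_phi_eq_one hP hQ f hprim hπP hπQ hμ hpos
    obtain ⟨u, hu, heig⟩ := exists_pos_eigenvector (hprim θ) hphi
    obtain ⟨ν, hν, -⟩ := exists_invariantProb (tiltedMatrix_mem hP.1 hQ.1 hu heig)
      (tiltedMatrix_isPrimitive (hprim θ) hu)
    refine ⟨θ, u, ν, hθ, hphi, fun h => ?_, heig, hν⟩
    obtain ⟨x⟩ := hE
    exact (hu (x, x)).ne' (congrFun h (x, x))
  · rintro θ r ν ⟨hθ, hphi, hr0, hr, hν⟩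
    obtain ⟨u, hu, heig⟩ := exists_pos_eigenvector (hprim θ) hphi
    have hR := tiltedMatrix_mem hP.1 hQ.1 hu heig
    have hRprim := tiltedMatrix_isPrimitive (hprim θ) hu
    rw [tiltedMatrix_eq (hprim θ) hR hu hr0 hr] at hν ⊢
    have hνpos := hν.pos hR hRprim
    have hPprim : P.IsPrimitive := by
      obtain ⟨N, hN⟩ := exists_forall_pow_pos hPirr hPap
      exact ⟨hP.1, N + 1, by omega, hN _ (by omega)⟩
    have hQprim : Q.IsPrimitive := by
      obtain ⟨N, hN⟩ := exists_forall_pow_pos hQirr hQap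
      exact ⟨hQ.1, N + 1, by omega, hN _ (by omega)⟩
    have hRpos : ∀ z z', 0 < tiltedMatrix P Q f θ u z z' ↔
        0 < P z.1 z'.1 ∧ 0 < Q z.2 z'.2 := fun z z' =>
      (mul_pos_iff_of_pos_left (div_pos (hu z') (hu z))).trans (Phi_pos_iff hP.1 hQ.1 f θ z z')
    have h1 : IsEntropyFactor Prod.fst ν (tiltedMatrix P Q f θ u) P
        (imageMatrix Prod.fst ν (tiltedMatrix P Q f θ u)) (marg₁ ν) := by
      rw [marg₁_eq]
      refine isEntropyFactor_imageMatrix Prod.fst_surjective hνpos hR hν fun x x' => ⟨?_, ?_⟩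
      · rintro ⟨z, z', rfl, rfl, h⟩
        exact ((hRpos z z').1 h).1
      · intro h
        obtain ⟨y', hy'⟩ := exists_pos_of_mem_rowStochastic hQ x
        exact ⟨(x, x), (x', y'), rfl, rfl, (hRpos _ _).2 ⟨h, hy'⟩⟩
    have h2 : IsEntropyFactor Prod.snd ν (tiltedMatrix P Q f θ u) Q
        (imageMatrix Prod.snd ν (tiltedMatrix P Q f θ u)) (marg₂ ν) := by
      rw [marg₂_eq]
      refine isEntropyFactor_imageMatrix Prod.snd_surjective hνpos hR hν fun y y' => ⟨?_, ?_⟩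
      · rintro ⟨z, z', rfl, rfl, h⟩
        exact ((hRpos z z').1 h).2
      · intro h
        obtain ⟨x', hx'⟩ := exists_pos_of_mem_rowStochastic hP y
        exact ⟨(y, y), (x', y'), rfl, rfl, (hRpos _ _).2 ⟨hx', h⟩⟩
    have h3 := isEntropyFactor_self Prod.fst ν (tiltedMatrix P Q f θ u) hP hπP
      (hπP.pos hP hPprim)
    have h4 := isEntropyFactor_self Prod.snd ν (tiltedMatrix P Q f θ u) hQ hπQ
      (hπQ.pos hQ hQprim)
    exact ⟨mean_prodVec_lt hP.1 hQ.1 hshift hθ hu hR hν h1 h4,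
      mean_prodVec_lt hP.1 hQ.1 hshift hθ hu hR hν h3 h2,
      tendsto_shiftedMean hR hRprim hν f,
      mean_prodVec_lt hP.1 hQ.1 hshift hθ hu hR hν h1 h2⟩
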